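/- Let $G$ be a finite connected bipartite distance hereditary (BDH) graph with colour classes $X$ and $Y$ (distance hereditary: every connected induced subgraph of $G$ has the same distances between its vertices as $G$). A biclique of $G$ is a set $B$ of vertices inducing a complete bipartite subgraph with both shores $X(B)=B\cap X$ and $Y(B)=B\cap Y$ nonempty. Let $\mathcal{L}^\circ(G)$ be the set of inclusionwise maximal bicliques of $G$, partially ordered by $B\preceq B'$ if and only if $X(B)\subseteq X(B')$ (this is the Galois lattice of $G$ without its two dummy elements $\bot$ and $\top$). Let $$\mathcal{F}=\{N(x)\cap N(x') : x,x'\in X,\ x\neq x'\}\cup\{N(x) : x\in X\}.$$ Then $B\mapsto Y(B)$ is an order isomorphism from $\mathcal{L}^\circ(G)$ onto the poset $(\mathcal{F}\setminus\{\emptyset\},\supseteq)$. Moreover, $\mathcal{L}^\circ(G)$ is realised as containment among dipaths in an arborescence: there exist an arborescence $T$ (a directed tree with a root from which there is a directed path to every node) and a bijection $\varphi$ from $Y$ onto the arc set of $T$ such that $\varphi(N(x))$ is the arc set of a directed path of $T$ for every $x\in X$, $\varphi(Y(B))$ is the arc set of a directed path $P_B$ of $T$ for every $B\in\mathcal{L}^\circ(G)$,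 and $B\preceq B'$ if and only if the arc set of $P_{B'}$ is contained in that of $P_B$. -/

import Mathlib

namespace GaloisBDH

universe u

/-- A graph is distance hereditary when every connected induced subgraph is isometric, i.e.
inherits the distance function of the whole graph. -/
def IsDistanceHereditary {V : Type u} (G : SimpleGraph V) : Prop :=
  ∀ S : Set V, (G.induce S).Connected →
    ∀ a b : S, (G.induce S).dist a b = G.dist (a : V) (b : V)

/-- `X` and `Y` are the colour classes of the bipartite graph `G`: they partition the vertex set,
and every edge joins `X` to `Y`. -/
structure IsColorClasses {V : Type u} (G : SimpleGraph V) (X Y : Set V) : Prop where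
  bipartite : G.IsBipartiteWith X Y
  cover : X ∪ Y = Set.univ

/-- A connected bipartite distance hereditary graph with colour classes `X` and `Y`. -/
structure IsConnectedBDH {V : Type u} (G : SimpleGraph V) (X Y : Set V) : Prop where
  connected : G.Connected
  colors : IsColorClasses G X Y
  hereditary : IsDistanceHereditary G

/-- A biclique of a bipartite graph with colour classes `X` and `Y`: a set of vertices inducing a
complete bipartite graph, i.e. both shores `B ∩ X` and `B ∩ Y` are nonempty and completely joined.
(The pairs with an empty shore are the dummy bottom and top of the Galois lattice and are not
bicliques.) -/
structure IsBiclique {V : Type u} (G : SimpleGraph V) (X Y B : Set V) : Prop where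
  nonempty_left : (B ∩ X).Nonempty
  nonempty_right : (B ∩ Y).Nonempty
  complete : G.IsCompleteBetween (B ∩ X) (B ∩ Y)

/-- The inclusionwise maximal bicliques: the elements of the Galois lattice without its dummy bottom
and top. -/
structure MaximalBiclique {V : Type u} (G : SimpleGraph V) (X Y : Set V) where
  carrier : Set V
  maximal : Maximal (IsBiclique G X Y) carrier

namespace MaximalBiclique

variable {V : Type u} {G : SimpleGraph V} {X Y : Set V}

/-- The shore of `B` in `X`. -/
def shoreX (B : MaximalBiclique G X Y) : Set V := B.carrier ∩ X

/-- The shore of `B` in `Y`. -/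
def shoreY (B : MaximalBiclique G X Y) : Set V := B.carrier ∩ Y

theorem carrier_subset_of_shoreX_eq {B C : MaximalBiclique G X Y} (h : B.shoreX = C.shoreX) :
    C.carrier ⊆ B.carrier := by
  have hX : (B.carrier ∪ C.carrier) ∩ X = B.carrier ∩ X := by
    rw [Set.union_inter_distrib_right]
    change B.shoreX ∪ C.shoreX = B.shoreX
    rw [← h, Set.union_self]
  have hb : IsBiclique G X Y (B.carrier ∪ C.carrier) := by
    refine ⟨?_, ?_, ?_⟩
    · rw [hX]
      exact B.maximal.prop.nonempty_left
    · exact B.maximal.prop.nonempty_right.mono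
        (Set.inter_subset_inter_left _ Set.subset_union_left)
    · rw [hX]
      intro x hx y hy
      rcases hy.1 with hB | hC
      · exact B.maximal.prop.complete hx ⟨hB, hy.2⟩
      · have hx' : x ∈ C.shoreX := h ▸ hx
        exact C.maximal.prop.complete hx' ⟨hC, hy.2⟩
  exact Set.subset_union_right.trans (B.maximal.le_of_ge hb Set.subset_union_left)

/-- The order of the Galois lattice: `B ≤ C` when the `X`-shore of `B` is contained in that
of `C`. -/
instance : PartialOrder (MaximalBiclique G X Y) where
  le B C := B.shoreX ⊆ C.shoreX
  le_refl _ := Set.Subset.rfl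
  le_trans _ _ _ := Set.Subset.trans
  le_antisymm B C h₁ h₂ := by
    have h := Set.Subset.antisymm h₁ h₂
    have hc : B.carrier = C.carrier :=
      Set.Subset.antisymm (carrier_subset_of_shoreX_eq h.symm) (carrier_subset_of_shoreX_eq h)
    cases B
    cases C
    cases hc
    rfl

end MaximalBiclique

/-- The family of all pairwise intersections `N(x) ∩ N(x')` with `x ≠ x'` in `X`, together with all
neighbourhoods `N(x)` with `x` in `X`. -/
def nbhdFamily {V : Type u} (G : SimpleGraph V) (X : Set V) : Set (Set V) :=
  {S | ∃ x ∈ X, ∃ x' ∈ X, x ≠ x' ∧ S = G.neighborSet x ∩ G.neighborSet x'} ∪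
    {S | ∃ x ∈ X, S = G.neighborSet x}

/-- The set of arcs traversed by a directed path. -/
def pathArcs {N : Type*} [Quiver N] {a : N} : {b : N} → Quiver.Path a b → Set (Quiver.Total N)
  | _, .nil => ∅
  | _, .cons p e => insert ⟨_, _, e⟩ (pathArcs p)

/-- A directed path in a directed graph, with its two end nodes. In an arborescence every such path
is simple: a repeated node would give two directed paths from the root to it. -/
structure Dipath (N : Type*) [Quiver N] where
  source : N
  target : N
  path : Quiver.Path source target

/-- The arc set of a dipath. -/
def Dipath.arcs {N : Type*} [Quiver N] (P : Dipath N) : Set (Quiver.Total N) := pathArcs P.path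

end GaloisBDH

/-! The heart is a forest order on `Y` (elements below a given one form a chain) in which every
N(x), x in X, is a convex chain. It is built by induction on induced subgraphs. A connected BDH
graph with at least two vertices has a pendant vertex or a twin
(`HasGeodesicSteps.exists_isPendantOrTwin`, an argument on distance levels); its removal keeps the
graph connected, and putting it back changes the order only locally (`exists_insert_above`,
`exists_insert_top`).

The shore Y(B) is the intersection of all N(x) with x in X(B). Convex chains through a common point
behave like subtrees of a path, so two of them already cut out the whole intersection
(`IsConvexChain.exists_inter_subset_forall`). Hence Y(B) is in F; conversely every nonempty N(x) ∩
N(x') is closed, so it is a shore.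

For the arborescence, add a bottom element as root and take covering pairs as arcs. Each y labels
the unique arc entering it, and convex chains become dipaths. -/

namespace GaloisBDH

universe u

/-! ### Distances from a root in a distance hereditary graph -/

section Elimination

variable {V : Type u} {G : SimpleGraph V}

/-- Every connected induced subgraph contains, for any two of its vertices `a ≠ b`, a neighbour
of `b` that is closer to `a` in the whole graph. -/
def HasGeodesicSteps (G : SimpleGraph V) : Prop :=
  ∀ T : Set V, (G.induce T).Connected → ∀ a ∈ T, ∀ b ∈ T, a ≠ b →
    ∃ z ∈ T, G.Adj b z ∧ G.dist a z < G.dist a b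

theorem exists_adj_dist_lt (hG : G.Connected) {a b : V} (h : a ≠ b) :
    ∃ z, G.Adj b z ∧ G.dist a z < G.dist a b := by
  obtain ⟨p, hp⟩ := hG.exists_walk_length_eq_dist b a
  cases p with
  | nil => exact absurd rfl h
  | cons hz q =>
    refine ⟨_, hz, ?_⟩
    rw [SimpleGraph.Walk.length_cons] at hp
    have := SimpleGraph.dist_le q
    rw [SimpleGraph.dist_comm, SimpleGraph.dist_comm (u := a)]
    omega

/-- This is the only form in which heredity is used. Distances in `S`, and in a connected subset of
`S`, both agree with those of `G`. -/
theorem IsDistanceHereditary.hasGeodesicSteps_induce (hG : IsDistanceHereditary G) {S : Set V}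
    (hS : (G.induce S).Connected) : HasGeodesicSteps (G.induce S) := by
  intro T hT a ha b hb hab
  let T' : Set V := Subtype.val '' T
  let f : (G.induce S).induce T →g G.induce T' :=
    { toFun := fun t => ⟨t.1.1, t.1, t.2, rfl⟩
      map_rel' := fun h => h }
  have hf : Function.Surjective f := by
    rintro ⟨_, t, ht, rfl⟩
    exact ⟨⟨t, ht⟩, rfl⟩
  have hT' : (G.induce T').Connected := hT.map f hf
  obtain ⟨⟨_, z, hz, rfl⟩, hbz, hlt⟩ := exists_adj_dist_lt hT'
    (a := ⟨a.1, a, ha, rfl⟩) (b := ⟨b.1, b, hb, rfl⟩)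
    (fun h => hab (Subtype.ext (congrArg (fun t : T' => t.1) h)))
  refine ⟨z, hz, hbz, ?_⟩
  rw [hG T' hT', hG T' hT'] at hlt
  rwa [hG S hS, hG S hS]

theorem induce_connected_of_descent {T : Set V} {r : V} (hr : r ∈ T) (f : V → ℕ)
    (h : ∀ z ∈ T, z ≠ r → ∃ z' ∈ T, G.Adj z z' ∧ f z' < f z) : (G.induce T).Connected := by
  have key : ∀ n, ∀ z (hz : z ∈ T), f z = n → (G.induce T).Reachable ⟨z, hz⟩ ⟨r, hr⟩ := by
    intro n
    induction n using Nat.strong_induction_on with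
    | _ n ih =>
      intro z hz hn
      by_cases hzr : z = r
      · subst hzr
        exact SimpleGraph.Reachable.refl _
      · obtain ⟨z', hz', hadj, hlt⟩ := h z hz hzr
        have hadj' : (G.induce T).Adj ⟨z, hz⟩ ⟨z', hz'⟩ := hadj
        exact hadj'.reachable.trans (ih (f z') (hn ▸ hlt) z' hz' rfl)
  exact (SimpleGraph.connected_iff_exists_forall_reachable _).2
    ⟨⟨r, hr⟩, fun z => (key _ z.1 z.2 rfl).symm⟩

variable (c : G.Coloring Bool)

-- Parity: the two colours alternate along walks from `u`, so no edge lies inside a distance level.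
include c in
theorem dist_eq_add_one_or_of_adj (hG : G.Connected) (u : V) {a b : V} (h : G.Adj a b) :
    G.dist u a = G.dist u b + 1 ∨ G.dist u b = G.dist u a + 1 := by
  have h1 := h.diff_dist_adj (u := u)
  obtain ⟨p, hp⟩ := hG.exists_walk_length_eq_dist u a
  obtain ⟨q, hq⟩ := hG.exists_walk_length_eq_dist u b
  have hp' := c.even_length_iff_congr p
  have hq' := c.even_length_iff_congr q
  have hc := c.valid h
  rw [hp] at hp'
  rw [hq] at hq'
  have : G.dist u a ≠ G.dist u b := by
    intro he
    rw [he] at hp'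
    revert hp' hq' hc
    generalize c u = x
    generalize c a = y
    generalize c b = z
    intro hp' hq' hc
    cases x <;> cases y <;> cases z <;> simp_all
  omega

end Elimination
-- Existence of a pendant vertex or a twin
section Elimination

variable {V : Type u} {G : SimpleGraph V} (c : G.Coloring Bool)

-- Two lower neighbours of `v` have the same lower neighbours. Otherwise a connected set can be
-- chosen in which `b` has no neighbour closer to `u`.
include c in
theorem HasGeodesicSteps.adj_lower (hG : G.Connected) (hs : HasGeodesicSteps G) {u v a b x : V}
    (hva : G.Adj v a) (hvb : G.Adj v b) (ha : G.dist u v = G.dist u a + 1)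
    (hb : G.dist u v = G.dist u b + 1) (hax : G.Adj a x) (hx : G.dist u a = G.dist u x + 1) :
    G.Adj b x := by
  classical
  by_contra hbx
  have hxu : u ≠ x := by
    rintro rfl
    rw [SimpleGraph.dist_self] at hx
    exact hbx (SimpleGraph.dist_eq_one_iff_adj.1 (by omega : G.dist u b = 1)).symm
  have hab : a ≠ b := by
    rintro rfl
    exact hbx hax
  -- The open ball below the level of `x`, together with the path x, a, v, b. By levels, the only
  -- vertex of `T` that could precede `b` on a geodesic from `u` is `x`.
  let T : Set V := {z | G.dist u z < G.dist u x ∨ z = b ∨ z = v ∨ z = a ∨ z = x}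
  have hpos := hG.pos_dist_of_ne hxu
  have huT : u ∈ T := Or.inl (by simpa using hpos)
  have hbT : b ∈ T := Or.inr (Or.inl rfl)
  have hT : (G.induce T).Connected := by
    refine induce_connected_of_descent huT
      -- Inside `T` the vertex `b` is reached through `v`, so its potential must exceed that of `v`.
      (fun z => if z = b then G.dist u v + 1 else G.dist u z) ?_
    have hvb' : v ≠ b := hvb.ne
    have hxb : x ≠ b := by
      rintro rfl
      omega
    have low : ∀ z, z ≠ u → z ≠ b → G.dist u z ≤ G.dist u x → ∃ z' ∈ T, G.Adj z z' ∧
        (if z' = b then G.dist u v + 1 else G.dist u z') <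
          (if z = b then G.dist u v + 1 else G.dist u z) := by
      intro z hzu hzb hz
      obtain ⟨z', h1, h2⟩ := exists_adj_dist_lt hG (Ne.symm hzu)
      have hz'b : z' ≠ b := by
        rintro rfl
        omega
      exact ⟨z', Or.inl (by omega), h1, by simpa [hzb, hz'b] using h2⟩
    rintro z hz hzu
    rcases hz with hz | rfl | rfl | rfl | rfl
    · refine low z hzu ?_ hz.le
      rintro rfl
      omega
    · exact ⟨v, by simp [T], hvb.symm, by simp [hvb']⟩
    · exact ⟨a, by simp [T], hva, by simp [hvb', hab]; omega⟩
    · exact ⟨x, by simp [T], hax, by simp [hxb, hab]; omega⟩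
    · exact low _ hzu hxb le_rfl
  obtain ⟨z, hz, hbz, hlt⟩ := hs T hT u huT b hbT (by
    rintro rfl
    rw [SimpleGraph.dist_self] at hb
    omega)
  have := dist_eq_add_one_or_of_adj c hG u hbz
  rcases hz with hz | rfl | rfl | rfl | rfl
  · omega
  · omega
  · omega
  · omega
  · exact hbx hbz

-- Otherwise b, v, a, w, x is an induced path, with ends at distance 4 in it; but `adj_lower` gives
-- `b` and `x` a common neighbour below `a`, so their distance in `G` is at most 2.
include c in
theorem HasGeodesicSteps.comparable_lower (hG : G.Connected) (hs : HasGeodesicSteps G)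
    {u v w a b x : V} (hva : G.Adj v a) (hwa : G.Adj w a) (hvb : G.Adj v b) (hwx : G.Adj w x)
    (hv : G.dist u v = G.dist u a + 1) (hw : G.dist u w = G.dist u a + 1)
    (hb : G.dist u v = G.dist u b + 1) (hx : G.dist u w = G.dist u x + 1) :
    G.Adj w b ∨ G.Adj v x := by
  classical
  by_contra! h
  obtain ⟨hwb, hvx⟩ := h
  have hab : a ≠ b := by
    rintro rfl
    exact hwb hwa
  have hax : a ≠ x := by
    rintro rfl
    exact hvx hva
  have hbx : b ≠ x := by
    rintro rfl
    exact hvx hvb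
  have hvw : v ≠ w := by
    rintro rfl
    exact hvx hwx
  have hua : u ≠ a := by
    rintro rfl
    rw [SimpleGraph.dist_self] at *
    exact hab (hG.dist_eq_zero_iff.1 (by omega : G.dist u b = 0))
  obtain ⟨y, hay, hy⟩ := exists_adj_dist_lt hG hua
  have hy' : G.dist u a = G.dist u y + 1 := by
    have := dist_eq_add_one_or_of_adj c hG u hay
    omega
  have hby := hs.adj_lower c hG hva hvb hv hb hay hy'
  have hxy := hs.adj_lower c hG hwa hwx hw hx hay hy'
  have hd : G.dist b x ≤ 2 :=
    SimpleGraph.dist_le (.cons hby (.cons hxy.symm .nil))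
  let T : Set V := {z | z = a ∨ z = v ∨ z = w ∨ z = b ∨ z = x}
  have hT : (G.induce T).Connected := by
    refine induce_connected_of_descent (r := a) (by simp [T])
      (fun z => if z = a then 0 else if z = v ∨ z = w then 1 else 2) ?_
    have h1 := hva.ne
    have h2 := hwa.ne
    have h3 := hvb.ne
    have h4 := hwx.ne
    have h5 : w ≠ b := by
      rintro rfl
      omega
    have h6 : v ≠ x := by
      rintro rfl
      omega
    rintro z hz hza
    rcases hz with rfl | rfl | rfl | rfl | rfl
    · exact absurd rfl hza
    · exact ⟨a, by simp [T], hva, by simp [h1]⟩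
    · exact ⟨a, by simp [T], hwa, by simp [h2]⟩
    · exact ⟨v, by simp [T], hvb.symm, by simp [h1, hza, h3.symm, h5.symm]⟩
    · exact ⟨w, by simp [T], hwx.symm, by simp [h2, hza, h4.symm, h6.symm]⟩
  obtain ⟨z, hz, hxz, hlt⟩ := hs T hT b (by simp [T]) x (by simp [T]) hbx
  have hz1 : G.dist b z ≤ 1 := by omega
  have hbz : b = z ∨ G.Adj b z := by
    by_cases hbz : b = z
    · exact Or.inl hbz
    · have := hG.pos_dist_of_ne hbz
      exact Or.inr (SimpleGraph.dist_eq_one_iff_adj.1 (by omega))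
  have hxz' := dist_eq_add_one_or_of_adj c hG u hxz
  have hbz' : b = z ∨ G.dist u b = G.dist u z + 1 ∨ G.dist u z = G.dist u b + 1 :=
    hbz.imp_right (dist_eq_add_one_or_of_adj c hG u)
  rcases hz with rfl | rfl | rfl | rfl | rfl
  · omega
  · exact hvx hxz.symm
  · rcases hbz with rfl | hbz
    · omega
    · exact hwb hbz.symm
  · omega
  · exact G.irrefl hxz

/-- `v` is pendant at `w`, or a twin of `w` with the same nonempty neighbourhood. -/
def IsPendantOrTwin (G : SimpleGraph V) (v w : V) : Prop :=
  v ≠ w ∧ ((∀ q, G.Adj v q ↔ q = w) ∨ ((∃ q, G.Adj v q) ∧ ∀ q, G.Adj v q ↔ G.Adj w q))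

include c in
theorem HasGeodesicSteps.exists_isPendantOrTwin [Finite V] [Nontrivial V] (hG : G.Connected)
    (hs : HasGeodesicSteps G) : ∃ v w, IsPendantOrTwin G v w := by
  obtain ⟨u⟩ := hG.nonempty
  obtain ⟨m, hm⟩ := Finite.exists_max (G.dist u)
  -- Take `v` of least degree on the last level. If `v` is not pendant, the twins found are two of
  -- its neighbours, not `v` itself.
  obtain ⟨v, hv, hmin⟩ := Set.exists_min_image {v | G.dist u v = G.dist u m}
    (fun v => (G.neighborSet v).ncard) (Set.toFinite _) ⟨m, rfl⟩
  have hv' : ∀ z, G.dist u z ≤ G.dist u v := fun z => (hm z).trans_eq hv.symm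
  have huv : u ≠ v := by
    rintro rfl
    obtain ⟨z, hz⟩ := exists_ne u
    have := hG.pos_dist_of_ne hz.symm
    have := hv' z
    rw [SimpleGraph.dist_self] at this
    omega
  have low : ∀ w z, G.dist u w = G.dist u v → G.Adj w z → G.dist u w = G.dist u z + 1 := by
    intro w z hw hwz
    have := dist_eq_add_one_or_of_adj c hG u hwz
    have := hv' z
    omega
  obtain ⟨a, hva, -⟩ := exists_adj_dist_lt hG huv
  by_cases hp : ∀ q, G.Adj v q → q = a
  · exact ⟨v, a, hva.ne, Or.inl fun q => ⟨hp q, fun h => h ▸ hva⟩⟩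
  push Not at hp
  obtain ⟨b, hvb, hba⟩ := hp
  have key : ∀ a b, G.Adj v a → G.Adj v b → ∀ q, G.Adj a q → G.Adj b q := by
    intro a b hva hvb q haq
    have ha := low v a rfl hva
    have hb := low v b rfl hvb
    rcases dist_eq_add_one_or_of_adj c hG u haq with hq | hq
    · exact hs.adj_lower c hG hva hvb ha hb haq hq
    · by_contra hbq
      -- Here `q` is also on the last level. If it misses `b`, comparability gives N(q) ⊆ N(v), and
      -- the least degree of `v` forces equality.
      have hqv : G.dist u q = G.dist u v := by omega
      have hsub : G.neighborSet q ⊆ G.neighborSet v := by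
        intro x hqx
        have hqx' : G.Adj q x := hqx
        rcases hs.comparable_lower c hG hva haq.symm hvb hqx' ha hq hb (low q x hqv hqx') with h | h
        · exact absurd h.symm hbq
        · exact h
      have hle := hmin q (hqv.trans hv)
      have heq := Set.eq_of_subset_of_ncard_le hsub hle (Set.toFinite _)
      have : b ∈ G.neighborSet q := heq ▸ hvb
      exact hbq (SimpleGraph.Adj.symm this)
  exact ⟨a, b, Ne.symm hba, Or.inr ⟨⟨v, hva.symm⟩,
    fun q => ⟨key a b hva hvb q, key b a hvb hva q⟩⟩⟩

/-- Sending `v` to `w` and fixing the rest turns each edge into an edge or a single vertex, so walks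
project to the complement of `v`. -/
theorem IsPendantOrTwin.induce_compl_connected (hG : G.Connected) {v w : V}
    (h : IsPendantOrTwin G v w) : (G.induce {v}ᶜ).Connected := by
  classical
  obtain ⟨hvw, h⟩ := h
  have h' : ∀ q, G.Adj v q → q = w ∨ G.Adj w q := fun q hq =>
    h.imp (fun h => (h q).1 hq) (fun h => (h.2 q).1 hq)
  let f : V → ({v}ᶜ : Set V) := fun z =>
    if hz : z = v then ⟨w, Ne.symm hvw⟩ else ⟨z, hz⟩
  have hf : ∀ p q, G.Adj p q → (G.induce {v}ᶜ).Reachable (f p) (f q) := by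
    have aux : ∀ q, G.Adj v q → (G.induce {v}ᶜ).Reachable (f v) (f q) := by
      intro q hq
      have hqv : q ≠ v := hq.ne'
      rcases h' q hq with rfl | hwq
      · simp [f, hqv]
      · have : (G.induce {v}ᶜ).Adj (f v) (f q) := by simpa [f, hqv] using hwq
        exact this.reachable
    intro p q hpq
    by_cases hp : p = v
    · subst hp
      exact aux q hpq
    by_cases hq : q = v
    · subst hq
      exact (aux p hpq.symm).symm
    · have : (G.induce {v}ᶜ).Adj (f p) (f q) := by simpa [f, hp, hq] using hpq
      exact this.reachable
  have hw : ∀ p q, G.Walk p q → (G.induce {v}ᶜ).Reachable (f p) (f q) := by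
    intro p q W
    induction W with
    | nil => exact SimpleGraph.Reachable.refl _
    | cons hadj _ ih => exact (hf _ _ hadj).trans ih
  have hfix : ∀ z : ({v}ᶜ : Set V), f z.1 = z := fun z => by
    have : z.1 ≠ v := z.2
    simp [f, this]
  refine (SimpleGraph.connected_iff_exists_forall_reachable _).2 ⟨⟨w, Ne.symm hvw⟩, fun z => ?_⟩
  obtain ⟨W⟩ := hG.preconnected w z.1
  have := hw _ _ W
  rwa [hfix ⟨w, Ne.symm hvw⟩, hfix z] at this

end Elimination
-- Forest orders and convex chains
section ForestOrder

variable {V : Type u}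

/-- A partial order whose principal lower sets are chains. -/
structure IsForestOrder (r : V → V → Prop) : Prop where
  refl : ∀ a, r a a
  antisymm : ∀ a b, r a b → r b a → a = b
  trans : ∀ a b d, r a b → r b d → r a d
  forest : ∀ a b d, r a d → r b d → r a b ∨ r b a

/-- `C` is a chain for `r` that is convex among the elements of `Y`. -/
structure IsConvexChain (r : V → V → Prop) (Y C : Set V) : Prop where
  subset : C ⊆ Y
  chain : ∀ a ∈ C, ∀ b ∈ C, r a b ∨ r b a
  convex : ∀ a ∈ C, ∀ b ∈ C, ∀ z ∈ Y, r a z → r z b → z ∈ C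

theorem IsConvexChain.inter {r : V → V → Prop} {Y C D : Set V} (hC : IsConvexChain r Y C)
    (hD : IsConvexChain r Y D) : IsConvexChain r Y (C ∩ D) where
  subset := Set.inter_subset_left.trans hC.subset
  chain a ha b hb := hC.chain a ha.1 b hb.1
  convex a ha b hb z hz h1 h2 :=
    ⟨hC.convex a ha.1 b hb.1 z hz h1 h2, hD.convex a ha.2 b hb.2 z hz h1 h2⟩

/-- On one side of `d`, the nearer of `p` and `q` lies between `d` and the other, so convexity puts
it into the other's chain. -/
theorem IsConvexChain.mem_of_mem_of_mem {r : V → V → Prop} {Y C₁ C₂ C₃ : Set V}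
    (h₁ : IsConvexChain r Y C₁) (h₂ : IsConvexChain r Y C₂) (h₃ : IsConvexChain r Y C₃) {d p q : V}
    (hd₁ : d ∈ C₁) (hd₂ : d ∈ C₂) (hp₂ : p ∈ C₂) (hp₃ : p ∈ C₃) (hq₁ : q ∈ C₁) (hq₃ : q ∈ C₃)
    (hpq : (r p d ∧ r q d) ∨ (r d p ∧ r d q)) : p ∈ C₁ ∨ q ∈ C₂ := by
  rcases hpq with ⟨hp, hq⟩ | ⟨hp, hq⟩ <;> rcases h₃.chain p hp₃ q hq₃ with h | h
  · exact Or.inr (h₂.convex p hp₂ d hd₂ q (h₁.subset hq₁) h hq)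
  · exact Or.inl (h₁.convex q hq₁ d hd₁ p (h₂.subset hp₂) h hp)
  · exact Or.inl (h₁.convex d hd₁ q hq₁ p (h₂.subset hp₂) hp h)
  · exact Or.inr (h₂.convex d hd₂ p hp₂ q (h₁.subset hq₁) hq h)

/-- Among three convex chains with a common element, some two have an intersection contained in
the third. -/
theorem IsConvexChain.exists_inter_subset {r : V → V → Prop} {Y C₁ C₂ C₃ : Set V}
    (h₁ : IsConvexChain r Y C₁) (h₂ : IsConvexChain r Y C₂) (h₃ : IsConvexChain r Y C₃) {d : V}
    (hd₁ : d ∈ C₁) (hd₂ : d ∈ C₂) (hd₃ : d ∈ C₃) :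
    C₂ ∩ C₃ ⊆ C₁ ∨ C₁ ∩ C₃ ⊆ C₂ ∨ C₁ ∩ C₂ ⊆ C₃ := by
  by_contra! h
  simp only [Set.not_subset] at h
  obtain ⟨⟨p, hp, hp'⟩, ⟨q, hq, hq'⟩, ⟨s, hs, hs'⟩⟩ := h
  -- Two of `p`, `q`, `s` lie on the same side of `d`; for that pair, one point falls into the chain
  -- it was chosen to avoid.
  have h12 := h₁.mem_of_mem_of_mem h₂ h₃ hd₁ hd₂ hp.1 hp.2 hq.1 hq.2
  have h13 := h₁.mem_of_mem_of_mem h₃ h₂ hd₁ hd₃ hp.2 hp.1 hs.1 hs.2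
  have h23 := h₂.mem_of_mem_of_mem h₃ h₁ hd₂ hd₃ hq.2 hq.1 hs.2 hs.1
  have hpd := h₂.chain p hp.1 d hd₂
  have hqd := h₁.chain q hq.1 d hd₁
  have hsd := h₁.chain s hs.1 d hd₁
  tauto

/-- In a finite family of convex chains with a common element, some two members have the same
intersection as the whole family. -/
theorem IsConvexChain.exists_inter_subset_forall [Finite V] {r : V → V → Prop} {Y : Set V}
    {ι : Type*} {A : Set ι} (hA : A.Nonempty) {N : ι → Set V}
    (hN : ∀ x ∈ A, IsConvexChain r Y (N x)) {d : V} (hd : ∀ x ∈ A, d ∈ N x) :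
    ∃ x ∈ A, ∃ x' ∈ A, ∀ x'' ∈ A, N x ∩ N x' ⊆ N x'' := by
  obtain ⟨x₀, hx₀⟩ := hA
  let F : Set (Set V) := {D | ∃ x ∈ A, ∃ x' ∈ A, D = N x ∩ N x'}
  obtain ⟨D, ⟨x, hx, x', hx', rfl⟩, hmin⟩ := Set.exists_min_image F Set.ncard (Set.toFinite _)
    ⟨_, x₀, hx₀, x₀, hx₀, rfl⟩
  refine ⟨x, hx, x', hx', fun x'' hx'' => ?_⟩
  rcases (hN x hx).exists_inter_subset (hN x' hx') (hN x'' hx'') (hd x hx) (hd x' hx')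
    (hd x'' hx'') with h | h | h
  · have := Set.eq_of_subset_of_ncard_le (s := N x' ∩ N x'') (t := N x ∩ N x')
      (fun z hz => ⟨h hz, hz.1⟩) (hmin _ ⟨x', hx', x'', hx'', rfl⟩) (Set.toFinite _)
    rw [← this]
    exact Set.inter_subset_right
  · have := Set.eq_of_subset_of_ncard_le (s := N x ∩ N x'') (t := N x ∩ N x')
      (fun z hz => ⟨hz.1, h hz⟩) (hmin _ ⟨x, hx, x'', hx'', rfl⟩) (Set.toFinite _)
    rw [← this]
    exact Set.inter_subset_right
  · exact h

/-- Putting a new element `v` immediately above `w` preserves forest orders. -/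
theorem IsForestOrder.exists_insert_above {r : V → V → Prop} (hr : IsForestOrder r) {v w : V}
    (hvw : v ≠ w) : ∃ s, IsForestOrder s ∧ ∀ Y C : Set V, v ∉ C → v ∈ Y → w ∈ Y →
      IsConvexChain r (Y \ {v}) C → IsConvexChain s Y (C ∪ {z | z = v ∧ w ∈ C}) := by
  classical
  -- The new order is `r` pulled back along the collapse of `v` onto `w`, with the relation of `v`
  -- below `w` deleted to break the tie.
  let p : V → V := fun z => if z = v then w else z
  have hp : ∀ z, (z = v ∧ p z = w) ∨ (z ≠ v ∧ p z = z) := by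
    intro z
    by_cases hz : z = v <;> simp [p, hz]
  have hpw : ∀ a b, p a = p b → a ≠ b → (a = v ∧ b = w) ∨ (a = w ∧ b = v) := by
    intro a b
    have := hp a
    have := hp b
    grind
  have hpv : p v = w := by simp [p]
  have hpw' : p w = w := by simp [p]
  refine ⟨fun a b => r (p a) (p b) ∧ ¬ (a = v ∧ b = w), ⟨?_, ?_, ?_, ?_⟩, ?_⟩
  · exact fun a => ⟨hr.refl _, by rintro ⟨rfl, rfl⟩; exact hvw rfl⟩
  · intro a b h1 h2
    by_contra hab
    have := hpw a b (hr.antisymm _ _ h1.1 h2.1) hab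
    tauto
  · rintro a b d ⟨h1, h1'⟩ ⟨h2, h2'⟩
    refine ⟨hr.trans _ _ _ h1 h2, ?_⟩
    rintro ⟨rfl, rfl⟩
    rw [hpv] at h1
    rw [hpw'] at h2
    have := hr.antisymm _ _ h1 h2
    have := hp b
    grind
  · rintro a b d ⟨h1, h1'⟩ ⟨h2, h2'⟩
    by_cases hab : a = v ∧ b = w
    · right
      obtain ⟨rfl, rfl⟩ := hab
      exact ⟨by rw [hpv, hpw']; exact hr.refl _, fun h => hvw h.2⟩
    by_cases hba : b = v ∧ a = w
    · left
      obtain ⟨rfl, rfl⟩ := hba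
      exact ⟨by rw [hpv, hpw']; exact hr.refl _, fun h => hvw h.2⟩
    · exact (hr.forest _ _ _ h1 h2).imp (⟨·, hab⟩) (⟨·, hba⟩)
  · intro Y C hvC hv hw hC
    have hmem : ∀ z, z ∈ C ∪ {z | z = v ∧ w ∈ C} ↔ p z ∈ C := by
      intro z
      rcases hp z with ⟨rfl, h⟩ | ⟨h, h'⟩
      · rw [h]
        simp [hvC]
      · rw [h']
        simp [h]
    refine ⟨?_, ?_, ?_⟩
    · rintro z (hz | ⟨rfl, -⟩)
      · exact (hC.subset hz).1
      · exact hv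
    · intro a ha b hb
      rw [hmem] at ha hb
      by_cases hab : a = v ∧ b = w
      · right
        obtain ⟨rfl, rfl⟩ := hab
        exact ⟨by rw [hpv, hpw']; exact hr.refl _, fun h => hvw h.2⟩
      by_cases hba : b = v ∧ a = w
      · left
        obtain ⟨rfl, rfl⟩ := hba
        exact ⟨by rw [hpv, hpw']; exact hr.refl _, fun h => hvw h.2⟩
      · exact (hC.chain _ ha _ hb).imp (⟨·, hab⟩) (⟨·, hba⟩)
    · rintro a ha b hb z hz ⟨h1, -⟩ ⟨h2, -⟩
      rw [hmem] at *
      refine hC.convex _ ha _ hb _ ?_ h1 h2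
      rcases hp z with ⟨h, h'⟩ | ⟨h, h'⟩
      · rw [h']
        exact ⟨hw, hvw.symm⟩
      · rw [h']
        exact ⟨hz, h⟩

/-- Putting a new maximal element `v` above a convex chain `D` preserves forest orders. -/
theorem IsForestOrder.exists_insert_top {r : V → V → Prop} (hr : IsForestOrder r) {v : V}
    {Y D : Set V} (hv : v ∈ Y) (hD : IsConvexChain r (Y \ {v}) D) : ∃ s, IsForestOrder s ∧
      (∀ C, IsConvexChain r (Y \ {v}) C → IsConvexChain s Y C) ∧
      IsConvexChain s Y (insert v D) := by
  have hne : ∀ {C}, IsConvexChain r (Y \ {v}) C → ∀ z ∈ C, z ≠ v := fun hC z hz =>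
    (hC.subset hz).2
  -- The down-closure of `D`. It is a chain, so placing `v` directly above it keeps lower sets
  -- chains.
  let L : V → Prop := fun a => a ≠ v ∧ ∃ b ∈ D, r a b
  have hL : ∀ a b, L a → L b → r a b ∨ r b a := by
    rintro a a' ⟨-, b, hb, hab⟩ ⟨-, b', hb', hab'⟩
    rcases hD.chain b hb b' hb' with h | h
    · exact hr.forest _ _ _ (hr.trans _ _ _ hab h) hab'
    · exact hr.forest _ _ _ hab (hr.trans _ _ _ hab' h)
  have hLd : ∀ a b, a ≠ v → r a b → L b → L a := by
    rintro a b hav hab ⟨-, d, hd, hbd⟩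
    exact ⟨hav, d, hd, hr.trans _ _ _ hab hbd⟩
  have hLv : ¬ L v := fun h => h.1 rfl
  have hDL : ∀ z ∈ D, L z := fun z hz => ⟨hne hD z hz, z, hz, hr.refl z⟩
  let s : V → V → Prop := fun a z => (z = v ∧ (a = v ∨ L a)) ∨ (z ≠ v ∧ a ≠ v ∧ r a z)
  have hs : ∀ a z, a ≠ v → z ≠ v → (s a z ↔ r a z) := by
    intro a z ha hz
    simp [s, ha, hz]
  have hsv : ∀ a, s a v ↔ a = v ∨ L a := by simp [s]
  have hvs : ∀ z, s v z ↔ z = v := by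
    intro z
    simp [s, hLv]
  refine ⟨s, ⟨?_, ?_, ?_, ?_⟩, ?_, ?_⟩
  · intro a
    by_cases ha : a = v
    · simp [s, ha]
    · simp [s, ha, hr.refl a]
  · rintro a b (⟨rfl, h1⟩ | ⟨h1, h1', h1''⟩) h2
    · exact (hvs _).1 h2
    · exact hr.antisymm _ _ h1'' ((hs _ _ h1 h1').1 h2)
  · rintro a b d h1 (⟨rfl, h2⟩ | ⟨h2, h2', h2''⟩)
    · rw [hsv]
      rcases h2 with rfl | h2
      · exact (hsv _).1 h1
      · by_cases ha : a = d
        · exact Or.inl ha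
        · exact Or.inr (hLd a b ha ((hs _ _ ha h2.1).1 h1) h2)
    · rcases h1 with ⟨rfl, h1⟩ | ⟨h1, h1', h1''⟩
      · exact absurd rfl h2'
      · exact Or.inr ⟨h2, h1', hr.trans _ _ _ h1'' h2''⟩
  · intro a b d h1 h2
    by_cases ha : a = v
    · subst ha
      rw [hvs] at h1
      subst h1
      exact Or.inr h2
    by_cases hb : b = v
    · subst hb
      rw [hvs] at h2
      subst h2
      exact Or.inl h1
    rw [hs a b ha hb, hs b a hb ha]
    by_cases hd : d = v
    · subst hd
      rw [hsv] at h1 h2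
      exact hL a b (h1.resolve_left ha) (h2.resolve_left hb)
    · exact hr.forest _ _ _ ((hs _ _ ha hd).1 h1) ((hs _ _ hb hd).1 h2)
  · intro C hC
    refine ⟨hC.subset.trans Set.sdiff_subset, ?_, ?_⟩
    · intro a ha b hb
      rw [hs _ _ (hne hC a ha) (hne hC b hb), hs _ _ (hne hC b hb) (hne hC a ha)]
      exact hC.chain a ha b hb
    · intro a ha b hb z hz h1 h2
      have hzv : z ≠ v := by
        rintro rfl
        exact hne hC b hb ((hvs _).1 h2)
      exact hC.convex a ha b hb z ⟨hz, hzv⟩ ((hs _ _ (hne hC a ha) hzv).1 h1)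
        ((hs _ _ hzv (hne hC b hb)).1 h2)
  · refine ⟨Set.insert_subset hv (hD.subset.trans Set.sdiff_subset), ?_, ?_⟩
    · rintro a (rfl | ha) b (rfl | hb)
      · exact Or.inl ((hvs _).2 rfl)
      · exact Or.inr ((hsv _).2 (Or.inr (hDL b hb)))
      · exact Or.inl ((hsv _).2 (Or.inr (hDL a ha)))
      · rw [hs _ _ (hne hD a ha) (hne hD b hb), hs _ _ (hne hD b hb) (hne hD a ha)]
        exact hD.chain a ha b hb
    · intro a ha b hb z hz h1 h2
      by_cases hzv : z = v
      · exact Or.inl hzv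
      have hav : a ≠ v := by
        rintro rfl
        exact hzv ((hvs _).1 h1)
      have haD := ha.resolve_left hav
      have h1' := (hs _ _ hav hzv).1 h1
      right
      rcases hb with rfl | hb
      · obtain ⟨-, e, he, hze⟩ := ((hsv _).1 h2).resolve_left hzv
        exact hD.convex a haD e he z ⟨hz, hzv⟩ h1' hze
      · exact hD.convex a haD b hb z ⟨hz, hzv⟩ h1' ((hs _ _ hzv (hne hD b hb)).1 h2)

theorem isForestOrder_eq : IsForestOrder (fun a b : V => a = b) where
  refl _ := rfl
  antisymm _ _ h _ := h
  trans _ _ _ h h' := h.trans h'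
  forest _ _ _ h h' := Or.inl (h.trans h'.symm)

end ForestOrder
-- Building the forest order by induction
section Induction

variable {V : Type u} {G : SimpleGraph V} {X Y : Set V}

theorem IsConnectedBDH.mem_right_of_adj (hG : IsConnectedBDH G X Y) {x y : V} (hx : x ∈ X)
    (h : G.Adj x y) : y ∈ Y := by
  rcases hG.colors.bipartite.mem_of_adj h with h | h
  · exact h.2
  · exact absurd h.1 (Set.disjoint_left.1 hG.colors.bipartite.disjoint hx)

theorem IsConnectedBDH.mem_left_of_adj (hG : IsConnectedBDH G X Y) {x y : V} (hy : y ∈ Y)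
    (h : G.Adj x y) : x ∈ X := by
  rcases hG.colors.bipartite.mem_of_adj h with h | h
  · exact h.1
  · exact absurd hy (Set.disjoint_left.1 hG.colors.bipartite.disjoint h.2)

theorem IsConnectedBDH.nonempty_coloring (hG : IsConnectedBDH G X Y) :
    Nonempty (G.Coloring Bool) := by
  classical
  refine ⟨SimpleGraph.Coloring.mk (fun v => decide (v ∈ X)) ?_⟩
  intro v w h
  have hd := Set.disjoint_left.1 hG.colors.bipartite.disjoint
  rcases hG.colors.bipartite.mem_of_adj h with h | h
  · have hw : w ∉ X := fun hw => hd hw h.2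
    simp [h.1, hw]
  · have hv : v ∉ X := fun hv => hd hv h.1
    simp [h.2, hv]

theorem isConvexChain_singleton {r : V → V → Prop} (hr : IsForestOrder r) {w : V} (hw : w ∈ Y) :
    IsConvexChain r Y {w} where
  subset := by simpa using hw
  chain := by
    rintro a rfl b rfl
    exact Or.inl (hr.refl _)
  convex := by
    rintro a rfl b rfl z - h1 h2
    exact hr.antisymm _ _ h2 h1

theorem connected_induce_diff_singleton {S : Set V} {v : S}
    (h : ((G.induce S).induce {v}ᶜ).Connected) : (G.induce (S \ {v.1})).Connected := by
  let f : (G.induce S).induce {v}ᶜ →g G.induce (S \ {v.1}) :=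
    { toFun := fun t => ⟨t.1.1, t.1.2, fun h => t.2 (Subtype.ext h)⟩
      map_rel' := fun h => h }
  refine h.map f ?_
  rintro ⟨z, hz, hzv⟩
  exact ⟨⟨⟨z, hz⟩, fun h => hzv (congrArg Subtype.val h)⟩, rfl⟩

/-- In a bipartite distance hereditary graph one colour class carries a forest order in which the
neighbourhoods of the vertices of the other class are convex chains. -/
theorem IsConnectedBDH.exists_isForestOrder_induce [Finite V] (hG : IsConnectedBDH G X Y) (n : ℕ) :
    ∀ S : Set V, S.ncard = n → (G.induce S).Connected → ∃ r : V → V → Prop, IsForestOrder r ∧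
      ∀ x ∈ X, x ∈ S → IsConvexChain r (Y ∩ S) (G.neighborSet x ∩ S) := by
  obtain ⟨c⟩ := hG.nonempty_coloring
  have hd := Set.disjoint_left.1 hG.colors.bipartite.disjoint
  induction n with
  | zero =>
    intro S hS hc
    obtain ⟨z⟩ := hc.nonempty
    rw [Set.ncard_eq_zero] at hS
    exact absurd (hS ▸ z.2 : z.1 ∈ (∅ : Set V)) (Set.notMem_empty _)
  | succ n ih =>
    intro S hS hc
    rcases subsingleton_or_nontrivial S with hsub | hnt
    · refine ⟨_, isForestOrder_eq, fun x hx hxS => ?_⟩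
      have : G.neighborSet x ∩ S = ∅ := by
        rw [Set.eq_empty_iff_forall_notMem]
        rintro z ⟨hz, hzS⟩
        have : x = z := congrArg Subtype.val (hsub.elim ⟨x, hxS⟩ ⟨z, hzS⟩)
        exact G.irrefl (this ▸ hz : G.Adj z z)
      rw [this]
      constructor <;> simp
    let c' : (G.induce S).Coloring Bool := c.comp (SimpleGraph.Embedding.induce S).toHom
    obtain ⟨v, w, hvw⟩ :=
      (hG.hereditary.hasGeodesicSteps_induce hc).exists_isPendantOrTwin c' hc
    have hconn := connected_induce_diff_singleton (hvw.induce_compl_connected hc)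
    obtain ⟨v, hv⟩ := v
    obtain ⟨w, hw⟩ := w
    have hne : v ≠ w := fun h => hvw.1 (Subtype.ext h)
    have hcard : (S \ {v}).ncard = n := by
      rw [Set.ncard_sdiff_singleton_of_mem hv, hS, Nat.add_sub_cancel]
    obtain ⟨r, hr, hN⟩ := ih (S \ {v}) hcard hconn
    have hcases : (∀ q ∈ S, G.Adj v q ↔ q = w) ∨
        ((∃ q ∈ S, G.Adj v q) ∧ ∀ q ∈ S, G.Adj v q ↔ G.Adj w q) := by
      rcases hvw.2 with h | ⟨⟨q, hq⟩, h⟩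
      · exact Or.inl fun q hq => (h ⟨q, hq⟩).trans Subtype.ext_iff
      · exact Or.inr ⟨⟨q.1, q.2, hq⟩, fun q hq => h ⟨q, hq⟩⟩
    have hY : Y ∩ (S \ {v}) = (Y ∩ S) \ {v} := (Set.inter_sdiff_assoc _ _ _).symm
    have hnbr : ∀ x, ¬ G.Adj x v → G.neighborSet x ∩ S = G.neighborSet x ∩ (S \ {v}) := by
      intro x hx
      ext z
      constructor
      · rintro ⟨hz, hzS⟩
        refine ⟨hz, hzS, ?_⟩
        rintro rfl
        exact hx hz
      · exact fun h => ⟨h.1, h.2.1⟩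
    rcases (hG.colors.cover ▸ Set.mem_univ v : v ∈ X ∪ Y) with hvX | hvY
    -- For `v` in `X` the order is unchanged: the new neighbourhood is a single point or equals that
    -- of `w`.
    · have hYv : Y ∩ S = Y ∩ (S \ {v}) := by
        rw [hY, Set.sdiff_singleton_eq_self]
        exact fun h => hd hvX h.1
      refine ⟨r, hr, fun x hx hxS => ?_⟩
      have hxv : ∀ x ∈ X, ¬ G.Adj x v := fun x hx h => hd hvX (hG.mem_right_of_adj hx h)
      by_cases hxv' : x = v
      · subst hxv'
        rcases hcases with h | ⟨⟨q, hq, hqv⟩, h⟩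
        · have : G.neighborSet x ∩ S = {w} := by
            ext z
            constructor
            · exact fun hz => (h z hz.2).1 hz.1
            · rintro rfl
              exact ⟨(h _ hw).2 rfl, hw⟩
          rw [this]
          exact isConvexChain_singleton hr ⟨hG.mem_right_of_adj hx ((h w hw).2 rfl), hw⟩
        · have hwX := hG.mem_left_of_adj (hG.mem_right_of_adj hx hqv) ((h q hq).1 hqv)
          have : G.neighborSet x ∩ S = G.neighborSet w ∩ S := by
            ext z
            exact and_congr_left fun hz => h z hz
          rw [this, hYv, hnbr w (hxv w hwX)]
          exact hN w hwX ⟨hw, Ne.symm hne⟩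
      · rw [hYv, hnbr x (hxv x hx)]
        exact hN x hx ⟨hxS, hxv'⟩
    · have hX : ∀ x ∈ X, x ≠ v := by
        rintro x hx rfl
        exact hd hx hvY
      rw [hY] at hN
      rcases hcases with h | ⟨⟨q, hq, hqv⟩, h⟩
      -- Pendant `v` in `Y`: only the neighbourhood of `w` grows, so `v` goes on top of that chain.
      · have hwX := hG.mem_left_of_adj hvY ((h w hw).2 rfl).symm
        obtain ⟨s, hs, hC, hD⟩ := hr.exists_insert_top (v := v) (Y := Y ∩ S) ⟨hvY, hv⟩
          (hN w hwX ⟨hw, hne.symm⟩)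
        refine ⟨s, hs, fun x hx hxS => ?_⟩
        by_cases hxw : x = w
        · subst hxw
          convert hD using 1
          ext z
          by_cases hz : z = v
          · subst hz
            simpa [hv] using ((h x hxS).2 rfl).symm
          · simp [hz]
        · rw [hnbr x fun hxv => hxw ((h x hxS).1 hxv.symm)]
          exact hC _ (hN x hx ⟨hxS, hX x hx⟩)
      -- Twin `v` in `Y`: a neighbourhood contains `v` exactly when it contains `w`, so `v` goes
      -- immediately above `w`.
      · have hwY := hG.mem_right_of_adj (hG.mem_left_of_adj hvY hqv.symm) ((h q hq).1 hqv).symm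
        obtain ⟨s, hs, hC⟩ := hr.exists_insert_above hne
        refine ⟨s, hs, fun x hx hxS => ?_⟩
        convert hC (Y ∩ S) (G.neighborSet x ∩ (S \ {v})) (by simp) ⟨hvY, hv⟩ ⟨hwY, hw⟩
          (hN x hx ⟨hxS, hX x hx⟩) using 1
        ext z
        by_cases hz : z = v
        · subst hz
          simpa [hv, hw, hne.symm, G.adj_comm x] using h x hxS
        · simp [hz]

theorem IsConnectedBDH.exists_isForestOrder [Finite V] (hG : IsConnectedBDH G X Y) :
    ∃ r : V → V → Prop, IsForestOrder r ∧ ∀ x ∈ X, IsConvexChain r Y (G.neighborSet x) := by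
  have hc : (G.induce Set.univ).Connected :=
    hG.connected.map
      ({ toFun := fun z => ⟨z, Set.mem_univ z⟩, map_rel' := fun h => h } : G →g G.induce Set.univ)
      fun z => ⟨z.1, rfl⟩
  obtain ⟨r, hr, hN⟩ := hG.exists_isForestOrder_induce _ Set.univ rfl hc
  refine ⟨r, hr, fun x hx => ?_⟩
  simpa using hN x hx (Set.mem_univ x)

end Induction
-- From a forest order to an arborescence
section Arborescence

variable {N : Type} [PartialOrder N]

/-- The directed graph of the covering relation of a partial order. -/
abbrev coverQuiver (N : Type) [PartialOrder N] : Quiver.{0, 0} N := ⟨fun a b => PLift (a ⋖ b)⟩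

theorem eq_of_covBy_of_covBy (hN : ∀ a b d : N, a ≤ d → b ≤ d → a ≤ b ∨ b ≤ a) {a b d : N}
    (ha : a ⋖ d) (hb : b ⋖ d) : a = b := by
  rcases hN a b d ha.le hb.le with h | h
  · exact h.eq_of_not_lt fun h' => ha.2 h' hb.lt
  · exact (h.eq_of_not_lt fun h' => hb.2 h' ha.lt).symm

theorem exists_covBy_of_ne_bot [Finite N] [OrderBot N] {b : N} (hb : b ≠ ⊥) : ∃ a, a ⋖ b := by
  obtain ⟨a, ha⟩ := (Set.toFinite (Set.Iio b)).exists_maximal ⟨⊥, bot_lt_iff_ne_bot.2 hb⟩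
  exact ⟨a, ha.prop, fun d had hdb => had.not_ge (ha.le_of_ge hdb had.le)⟩

/-- The covering relation of a finite forest order with a least element is an arborescence. -/
noncomputable abbrev coverArborescence [Finite N] [OrderBot N]
    (hN : ∀ a b d : N, a ≤ d → b ≤ d → a ≤ b ∨ b ≤ a) :
    @Quiver.Arborescence N (coverQuiver N) :=
  letI := coverQuiver N
  Quiver.arborescenceMk (⊥ : N) (fun a => (Set.Iic a).ncard)
    (fun _ _ h => Set.ncard_lt_ncard (Set.Iic_ssubset_Iic.2 h.down.lt) (Set.toFinite _))
    (fun a b d e f => by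
      obtain rfl := eq_of_covBy_of_covBy hN e.down f.down
      exact ⟨rfl, heq_of_eq (Subsingleton.elim (α := PLift (a ⋖ d)) e f)⟩)
    (fun b => by
      by_cases hb : b = ⊥
      · exact Or.inl hb
      · obtain ⟨a, ha⟩ := exists_covBy_of_ne_bot hb
        exact Or.inr ⟨a, ⟨⟨ha⟩⟩⟩)

/-- Everything strictly below `b` lies below its unique lower cover, so the path is built by
descending through lower covers; an arc is determined by its head. -/
theorem exists_path_pathArcs [Finite N] [OrderBot N]
    (hN : ∀ a b d : N, a ≤ d → b ≤ d → a ≤ b ∨ b ≤ a) {a b : N} (hab : a ≤ b) :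
    letI := coverQuiver N
    ∃ p : Quiver.Path a b, ∀ e, e ∈ pathArcs p ↔ a < e.right ∧ e.right ≤ b := by
  let _ := coverQuiver N
  induction b using (wellFounded_lt (α := N)).induction with
  | _ b ih =>
    rcases hab.eq_or_lt with rfl | hlt
    · exact ⟨.nil, fun e => by simpa [pathArcs] using fun h : a < e.right => h.not_ge⟩
    · obtain ⟨d, hd⟩ := exists_covBy_of_ne_bot (bot_le.trans_lt hlt).ne'
      have hle : ∀ z, z < b → z ≤ d := by
        intro z hz
        rcases hN z d b hz.le hd.le with h | h
        · exact h
        · exact (h.eq_of_not_lt fun h' => hd.2 h' hz).ge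
      obtain ⟨p, hp⟩ := ih d hd.lt (hle a hlt)
      refine ⟨p.cons ⟨hd⟩, fun e => ?_⟩
      rw [pathArcs, Set.mem_insert_iff, hp]
      constructor
      · rintro (rfl | h)
        · exact ⟨hlt, le_rfl⟩
        · exact ⟨h.1, h.2.trans hd.le⟩
      · rintro ⟨h1, h2⟩
        rcases h2.eq_or_lt with h2 | h2
        · left
          obtain ⟨l, r, ⟨h⟩⟩ := e
          obtain rfl : r = b := h2
          obtain rfl := eq_of_covBy_of_covBy hN h hd
          rfl
        · exact Or.inr ⟨h1, hle _ h2⟩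

theorem forest_withBot {α : Type} [PartialOrder α]
    (hα : ∀ a b d : α, a ≤ d → b ≤ d → a ≤ b ∨ b ≤ a) (a b d : WithBot α) (ha : a ≤ d)
    (hb : b ≤ d) : a ≤ b ∨ b ≤ a := by
  induction a with
  | bot => exact Or.inl bot_le
  | coe a =>
    induction b with
    | bot => exact Or.inr bot_le
    | coe b =>
      induction d with
      | bot => simp at ha
      | coe d =>
        rw [WithBot.coe_le_coe] at *
        rw [WithBot.coe_le_coe]
        exact hα a b d ha hb

theorem exists_arborescence_dipath {α : Type} [Finite α] [PartialOrder α]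
    (hα : ∀ a b d : α, a ≤ d → b ≤ d → a ≤ b ∨ b ≤ a) :
    ∃ (N : Type) (_ : Quiver.{0, 0} N) (_ : Quiver.Arborescence N) (φ : α ≃ Quiver.Total N),
      ∀ C : Set α, IsChain (· ≤ ·) C → C.OrdConnected → ∃ P : Dipath N, P.arcs = φ '' C := by
  let _ := coverQuiver (WithBot α)
  have hN := forest_withBot hα
  have : Finite (WithBot α) := inferInstanceAs (Finite (Option α))
  choose p hp using fun a : α => exists_covBy_of_ne_bot (WithBot.coe_ne_bot (a := a))
  let f : α → Quiver.Total (WithBot α) := fun a => ⟨p a, a, ⟨hp a⟩⟩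
  have hf : Function.Bijective f := by
    constructor
    · intro a b h
      exact WithBot.coe_injective (congrArg Quiver.Total.right h)
    · rintro ⟨l, r, ⟨h⟩⟩
      obtain ⟨a, rfl⟩ := WithBot.ne_bot_iff_exists.1 (bot_le.trans_lt h.lt).ne'
      obtain rfl := eq_of_covBy_of_covBy hN h (hp a)
      exact ⟨a, rfl⟩
  refine ⟨WithBot α, coverQuiver _, coverArborescence hN, Equiv.ofBijective f hf, fun C hC hC' => ?_⟩
  rcases C.eq_empty_or_nonempty with rfl | hne
  · exact ⟨⟨⊥, ⊥, .nil⟩, by simp [Dipath.arcs, pathArcs]⟩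
  obtain ⟨m, hm⟩ := (Set.toFinite C).exists_minimal hne
  obtain ⟨M, hM⟩ := (Set.toFinite C).exists_maximal hne
  have hm' : ∀ a ∈ C, m ≤ a := fun a ha => (hC.total hm.prop ha).elim id fun h => hm.le_of_le ha h
  have hM' : ∀ a ∈ C, a ≤ M := fun a ha => (hC.total ha hM.prop).elim id fun h => hM.le_of_ge ha h
  -- The path starts at `p m`, one node below `m`, so that it includes the arc labelled `m`.
  obtain ⟨q, hq⟩ := exists_path_pathArcs hN
    ((hp m).le.trans (WithBot.coe_le_coe.2 (hm' M hM.prop)))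
  refine ⟨⟨_, _, q⟩, ?_⟩
  ext e
  obtain ⟨a, rfl⟩ := hf.2 e
  have himg : f a ∈ Equiv.ofBijective f hf '' C ↔ a ∈ C := hf.1.mem_set_image
  rw [himg]
  change f a ∈ pathArcs q ↔ _
  rw [hq]
  change p m < (a : WithBot α) ∧ (a : WithBot α) ≤ M ↔ a ∈ C
  rw [WithBot.coe_le_coe]
  constructor
  · rintro ⟨h1, h2⟩
    refine hC'.out hm.prop hM.prop ⟨?_, h2⟩
    rcases hα m a M (hm' M hM.prop) h2 with h | h
    · exact h
    · exact (h.eq_of_not_lt fun h' => (hp m).2 h1 (WithBot.coe_lt_coe.2 h')).ge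
  · exact fun ha => ⟨(hp m).lt.trans_le (WithBot.coe_le_coe.2 (hm' a ha)), hM' a ha⟩

theorem IsForestOrder.exists_arborescence {V : Type*} [Finite V] {r : V → V → Prop}
    (hr : IsForestOrder r) (Y : Set V) :
    ∃ (N : Type) (_ : Quiver.{0, 0} N) (_ : Quiver.Arborescence N) (φ : Y ≃ Quiver.Total N),
      ∀ C : Set V, IsConvexChain r Y C → ∃ P : Dipath N, P.arcs = φ '' {y : Y | (y : V) ∈ C} := by
  -- Transport to `Fin n` puts the nodes in `Type`, whatever the universe of `V`.
  obtain ⟨n, ⟨e⟩⟩ := Finite.exists_equiv_fin Y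
  let _ : PartialOrder (Fin n) :=
    { le := fun a b => r (e.symm a) (e.symm b)
      lt := fun a b => r (e.symm a) (e.symm b) ∧ ¬ r (e.symm b) (e.symm a)
      lt_iff_le_not_ge := fun _ _ => Iff.rfl
      le_refl := fun a => hr.refl _
      le_trans := fun _ _ _ => hr.trans _ _ _
      le_antisymm := fun a b h h' => e.symm.injective (Subtype.ext (hr.antisymm _ _ h h')) }
  obtain ⟨N, hQ, hA, φ, h⟩ := exists_arborescence_dipath (α := Fin n)
    (fun a b d => hr.forest (e.symm a) (e.symm b) (e.symm d))
  refine ⟨N, hQ, hA, e.trans φ, fun C hC => ?_⟩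
  obtain ⟨P, hP⟩ := h {a | (e.symm a : V) ∈ C}
    (fun a ha b hb _ => hC.chain _ ha _ hb)
    ⟨fun a ha b hb z hz => hC.convex _ ha _ hb _ (e.symm z).2 hz.1 hz.2⟩
  refine ⟨P, hP.trans ?_⟩
  ext t
  simp only [Set.mem_image, Set.mem_ofPred_eq, Equiv.trans_apply]
  constructor
  · rintro ⟨a, ha, rfl⟩
    exact ⟨e.symm a, ha, by simp⟩
  · rintro ⟨y, hy, rfl⟩
    exact ⟨e y, by simpa using hy, rfl⟩

end Arborescence
-- Shores of maximal bicliques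
namespace MaximalBiclique

variable {V : Type u} {G : SimpleGraph V} {X Y : Set V}

theorem adj (B : MaximalBiclique G X Y) {x y : V} (hx : x ∈ B.shoreX) (hy : y ∈ B.shoreY) :
    G.Adj x y :=
  B.maximal.prop.complete hx hy

/-- Maximality: a vertex joined to the whole opposite shore can be added to the biclique. -/
theorem mem_shoreX_iff (hG : IsConnectedBDH G X Y) (B : MaximalBiclique G X Y) {x : V} :
    x ∈ B.shoreX ↔ x ∈ X ∧ B.shoreY ⊆ G.neighborSet x := by
  refine ⟨fun hx => ⟨hx.2, fun y hy => B.adj hx hy⟩, fun ⟨hx, hN⟩ => ⟨?_, hx⟩⟩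
  have hxY : x ∉ Y := Set.disjoint_left.1 hG.colors.bipartite.disjoint hx
  have hb : IsBiclique G X Y (insert x B.carrier) := by
    refine ⟨B.maximal.prop.nonempty_left.mono
      (Set.inter_subset_inter_left _ (Set.subset_insert _ _)), ?_, ?_⟩
    · rw [Set.insert_inter_of_notMem hxY]
      exact B.maximal.prop.nonempty_right
    · rw [Set.insert_inter_of_notMem hxY]
      rintro z ⟨rfl | hz, hzX⟩ y hy
      · exact hN hy
      · exact B.maximal.prop.complete ⟨hz, hzX⟩ hy
  exact B.maximal.le_of_ge hb (Set.subset_insert _ _) (Set.mem_insert _ _)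

theorem mem_shoreY_iff (hG : IsConnectedBDH G X Y) (B : MaximalBiclique G X Y) {y : V} :
    y ∈ B.shoreY ↔ y ∈ Y ∧ ∀ x ∈ B.shoreX, G.Adj x y := by
  refine ⟨fun hy => ⟨hy.2, fun x hx => B.adj hx hy⟩, fun ⟨hy, hN⟩ => ⟨?_, hy⟩⟩
  have hyX : y ∉ X := Set.disjoint_right.1 hG.colors.bipartite.disjoint hy
  have hb : IsBiclique G X Y (insert y B.carrier) := by
    refine ⟨?_, B.maximal.prop.nonempty_right.mono
      (Set.inter_subset_inter_left _ (Set.subset_insert _ _)), ?_⟩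
    · rw [Set.insert_inter_of_notMem hyX]
      exact B.maximal.prop.nonempty_left
    · rw [Set.insert_inter_of_notMem hyX]
      rintro x hx z ⟨rfl | hz, hzY⟩
      · exact hN x hx
      · exact B.maximal.prop.complete hx ⟨hz, hzY⟩
  exact B.maximal.le_of_ge hb (Set.subset_insert _ _) (Set.mem_insert _ _)

theorem le_iff_shoreY_subset (hG : IsConnectedBDH G X Y) {B C : MaximalBiclique G X Y} :
    B ≤ C ↔ C.shoreY ⊆ B.shoreY := by
  constructor
  · intro h y hy
    rw [mem_shoreY_iff hG] at *
    exact ⟨hy.1, fun x hx => hy.2 x (h hx)⟩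
  · intro h x hx
    rw [mem_shoreX_iff hG] at *
    exact ⟨hx.1, h.trans hx.2⟩

theorem exists_shoreY_eq_inter (hG : IsConnectedBDH G X Y) {x x' : V} (hx : x ∈ X) (hx' : x' ∈ X)
    (hne : (G.neighborSet x ∩ G.neighborSet x').Nonempty) :
    ∃ B : MaximalBiclique G X Y, B.shoreY = G.neighborSet x ∩ G.neighborSet x' := by
  set D := G.neighborSet x ∩ G.neighborSet x' with hD
  have hDY : D ⊆ Y := fun y hy => hG.mem_right_of_adj hx hy.1
  -- All common neighbours of `D` in `X`. As `x` and `x'` are among them, no further vertex of `Y`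
  -- can be added.
  let A : Set V := {z | z ∈ X ∧ D ⊆ G.neighborSet z}
  have hd := hG.colors.bipartite.disjoint
  have hX : (A ∪ D) ∩ X = A := by
    rw [Set.union_inter_distrib_right, Set.inter_eq_left.2 (fun z hz => hz.1),
      (hd.mono_right hDY).symm.inter_eq, Set.union_empty]
  have hY : (A ∪ D) ∩ Y = D := by
    rw [Set.union_inter_distrib_right, Set.inter_eq_left.2 hDY,
      (hd.mono_left (fun z (hz : z ∈ A) => hz.1)).inter_eq, Set.empty_union]
  have hxA : x ∈ A := ⟨hx, Set.inter_subset_left⟩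
  have hx'A : x' ∈ A := ⟨hx', Set.inter_subset_right⟩
  have hb : IsBiclique G X Y (A ∪ D) := by
    refine ⟨?_, ?_, ?_⟩
    · rw [hX]
      exact ⟨x, hxA⟩
    · rwa [hY]
    · rw [hX, hY]
      exact fun z hz y hy => hz.2 hy
  refine ⟨⟨A ∪ D, hb, fun B hB hle z hz => ?_⟩, hY⟩
  rcases (hG.colors.cover ▸ Set.mem_univ z : z ∈ X ∪ Y) with hzX | hzY
  · exact Or.inl ⟨hzX, fun y hy => hB.complete ⟨hz, hzX⟩ ⟨hle (Or.inr hy), hDY hy⟩⟩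
  · exact Or.inr ⟨hB.complete ⟨hle (Or.inl hxA), hx⟩ ⟨hz, hzY⟩,
      hB.complete ⟨hle (Or.inl hx'A), hx'⟩ ⟨hz, hzY⟩⟩

theorem shoreY_eq_inter [Finite V] (hG : IsConnectedBDH G X Y) {r : V → V → Prop}
    (hN : ∀ x ∈ X, IsConvexChain r Y (G.neighborSet x)) (B : MaximalBiclique G X Y) :
    ∃ x ∈ X, ∃ x' ∈ X, B.shoreY = G.neighborSet x ∩ G.neighborSet x' := by
  obtain ⟨d, hd⟩ := B.maximal.prop.nonempty_right
  obtain ⟨x, hx, x', hx', h⟩ := IsConvexChain.exists_inter_subset_forall (A := B.shoreX)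
    (N := G.neighborSet) B.maximal.prop.nonempty_left (fun x hx => hN x hx.2)
    (d := d) (fun x hx => B.adj hx hd)
  refine ⟨x, hx.2, x', hx'.2, Set.Subset.antisymm (fun y hy => ⟨B.adj hx hy, B.adj hx' hy⟩) ?_⟩
  intro y hy
  exact (B.mem_shoreY_iff hG).2 ⟨hG.mem_right_of_adj hx.2 hy.1, fun z hz => h z hz hy⟩

end MaximalBiclique

/-- Allowing x = x' absorbs the single neighbourhoods. -/
theorem mem_nbhdFamily_iff {V : Type u} {G : SimpleGraph V} {X S : Set V} :
    S ∈ nbhdFamily G X ↔ ∃ x ∈ X, ∃ x' ∈ X, S = G.neighborSet x ∩ G.neighborSet x' := by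
  constructor
  · rintro (⟨x, hx, x', hx', -, rfl⟩ | ⟨x, hx, rfl⟩)
    · exact ⟨x, hx, x', hx', rfl⟩
    · exact ⟨x, hx, x, hx, (Set.inter_self _).symm⟩
  · rintro ⟨x, hx, x', hx', rfl⟩
    by_cases h : x = x'
    · subst h
      exact Or.inr ⟨x, hx, Set.inter_self _⟩
    · exact Or.inl ⟨x, hx, x', hx', h, rfl⟩

/-- The map sending a maximal biclique to its `Y`-shore is an isomorphism onto the nonempty members
of the family of neighbourhoods and their pairwise intersections. -/
theorem exists_orderIso_nbhdFamily {V : Type u} [Finite V] {G : SimpleGraph V} {X Y : Set V}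
    (hG : IsConnectedBDH G X Y) {r : V → V → Prop}
    (hN : ∀ x ∈ X, IsConvexChain r Y (G.neighborSet x)) :
    ∃ e : MaximalBiclique G X Y ≃o (↥(nbhdFamily G X \ {(∅ : Set V)}))ᵒᵈ,
      ∀ B, ((OrderDual.ofDual (e B) : ↥(nbhdFamily G X \ {(∅ : Set V)})) : Set V) = B.shoreY := by
  let f : MaximalBiclique G X Y → (↥(nbhdFamily G X \ {(∅ : Set V)}))ᵒᵈ := fun B =>
    OrderDual.toDual ⟨B.shoreY, mem_nbhdFamily_iff.2 (B.shoreY_eq_inter hG hN),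
      B.maximal.prop.nonempty_right.ne_empty⟩
  let g : MaximalBiclique G X Y ↪o (↥(nbhdFamily G X \ {(∅ : Set V)}))ᵒᵈ :=
    OrderEmbedding.ofMapLEIff f fun B C => (MaximalBiclique.le_iff_shoreY_subset hG).symm
  refine ⟨RelIso.ofSurjective g ?_, fun B => rfl⟩
  rintro ⟨S, hS, hne⟩
  obtain ⟨x, hx, x', hx', rfl⟩ := mem_nbhdFamily_iff.1 hS
  obtain ⟨B, hB⟩ := MaximalBiclique.exists_shoreY_eq_inter hG hx hx'
    (Set.nonempty_iff_ne_empty.2 hne)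
  exact ⟨B, congrArg OrderDual.toDual (Subtype.ext hB)⟩

end GaloisBDH

/-- Let `G` be a finite connected bipartite distance hereditary graph with colour classes `X`, `Y`.
Mapping a maximal biclique to its `Y`-shore is an isomorphism from the poset of maximal bicliques
(ordered by their `X`-shores) onto the nonempty members of the family of neighbourhoods and pairwise
intersections of neighbourhoods of vertices of `X`, ordered by reverse inclusion. Moreover there is
an arborescence with arc set `Y` in which the neighbourhoods of the vertices of `X` and the
`Y`-shores of the maximal bicliques are arc sets of dipaths, so that the poset is realised as
(reverse) containment among these dipaths. -/
theorem corollary3 {V : Type*} [Finite V] (G : SimpleGraph V) (X Y : Set V)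
    (hG : GaloisBDH.IsConnectedBDH G X Y) :
    (∃ e : GaloisBDH.MaximalBiclique G X Y ≃o
        (↥(GaloisBDH.nbhdFamily G X \ {(∅ : Set V)}))ᵒᵈ,
      ∀ B, ((OrderDual.ofDual (e B) : ↥(GaloisBDH.nbhdFamily G X \ {(∅ : Set V)})) : Set V)
        = B.shoreY) ∧
    (∃ (N : Type) (_ : Quiver.{0, 0} N) (_ : Quiver.Arborescence N) (φ : Y ≃ Quiver.Total N),
      (∀ x ∈ X, ∃ P : GaloisBDH.Dipath N,
        P.arcs = φ '' {y : Y | (y : V) ∈ G.neighborSet x}) ∧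
      ∃ P : GaloisBDH.MaximalBiclique G X Y → GaloisBDH.Dipath N,
        (∀ B, (P B).arcs = φ '' {y : Y | (y : V) ∈ B.shoreY}) ∧
        ∀ B C, B ≤ C ↔ (P C).arcs ⊆ (P B).arcs) := by
  obtain ⟨r, hr, hN⟩ := hG.exists_isForestOrder
  refine ⟨GaloisBDH.exists_orderIso_nbhdFamily hG hN, ?_⟩
  obtain ⟨N, hQ, hA, φ, h⟩ := hr.exists_arborescence Y
  refine ⟨N, hQ, hA, φ, fun x hx => h _ (hN x hx), ?_⟩
  -- A shore is an intersection of two convex chains, hence again a convex chain.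
  have hB : ∀ B : GaloisBDH.MaximalBiclique G X Y, ∃ P : GaloisBDH.Dipath N,
      P.arcs = φ '' {y : Y | (y : V) ∈ B.shoreY} := by
    intro B
    obtain ⟨x, hx, x', hx', hS⟩ := B.shoreY_eq_inter hG hN
    exact h _ (hS ▸ (hN x hx).inter (hN x' hx'))
  choose P hP using hB
  refine ⟨P, hP, fun B C => ?_⟩
  rw [GaloisBDH.MaximalBiclique.le_iff_shoreY_subset hG, hP, hP,
    Set.image_subset_image_iff φ.injective]
  exact ⟨fun hs y hy => hs hy, fun hs y hy => hs (a := ⟨y, hy.2⟩) hy⟩
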